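/- All rings are commutative with identity. An element $v$ of a free $R$-module $F$ of finite rank is called unimodular if its coordinates generate the unit ideal of $R$. A ring $R$ is a Hermite ring if for every $(p,q)\in R^2$ there exist $d\in R$ and a unimodular pair $(p',q')\in R^2$ with $(p,q)=(dp',dq')$. A matrix over $R$ admits diagonal reduction if it is equivalent, via left and right multiplication by invertible matrices over $R$, to a rectangular matrix whose off-diagonal entries are $0$ and each of whose diagonal entries divides the next one; $R$ is an elementary divisor ring (EDR) if every rectangular matrix over $R$ admits diagonal reduction. A $2\times 2$ matrix over $R$ is extendable if it is obtained from a matrix in $SL_3(R)$ by removing the third row and the third column; $R$ is a $\Pi_2$ ring if every unimodular $2\times 2$ matrix over $R$ of zero determinant is extendable. A $2\times 2$ matrix $A$ over $R$ is weakly determinant liftable if there exists a $2\times 2$ matrix $B$ over $R$ with $\det(B)=0$ all of whose entries are congruent to those of $A$ modulo the ideal $R\det(A)$. **Theorem.** Let $R$ be a reduced Hermite ring. Then $R$ is an EDR if and only if the following two conditions hold: (i) for every $a\in R$, the quotient ring $R/\mathrm{Ann}_R(a)$ is a $\Pi_2$ ring; (ii) every unimodular $2\times 2$ matrix over $R$ is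 weakly determinant liftable. Moreover, condition (ii) is equivalent to the following: for every unimodular triple $(a,b,c)\in R^3$ there exists $(x,y,z,w)\in R^4$ such that $$(1-ax)(1-cw)=y(b+acz).$$ -/

import Mathlib

/-- An element `v` of a free `R`-module `F` is unimodular if some linear form takes the value `1`
at `v`; for `F = ι → R` or `F = Matrix m n R` with finite index types this says that the
entries of `v` generate the unit ideal. -/
def IsUnimodular (R : Type*) [CommRing R] {F : Type*} [AddCommGroup F] [Module R F] (v : F) :
    Prop :=
  ∃ f : F →ₗ[R] R, f v = 1

/-- Hermite ring in the sense of Kaplansky: `R² = R · Um(R²)`. -/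
def IsHermiteRing (R : Type*) [CommRing R] : Prop :=
  ∀ v : Fin 2 → R, ∃ (d : R) (u : Fin 2 → R), IsUnimodular R u ∧ v = d • u

/-- An `m × n` matrix admits diagonal reduction if it is equivalent to a matrix whose off-diagonal
entries vanish and each of whose diagonal entries divides the next one. -/
def AdmitsDiagonalReduction {R : Type*} [CommRing R] {m n : ℕ} (A : Matrix (Fin m) (Fin n) R) :
    Prop :=
  ∃ (M : GL (Fin m) R) (N : GL (Fin n) R) (D : Matrix (Fin m) (Fin n) R),
    (M : Matrix (Fin m) (Fin m) R) * A * (N : Matrix (Fin n) (Fin n) R) = D ∧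
    (∀ (i : Fin m) (j : Fin n), (i : ℕ) ≠ (j : ℕ) → D i j = 0) ∧
    (∀ (k : ℕ) (hm : k + 1 < m) (hn : k + 1 < n),
      D ⟨k, Nat.lt_of_succ_lt hm⟩ ⟨k, Nat.lt_of_succ_lt hn⟩ ∣ D ⟨k + 1, hm⟩ ⟨k + 1, hn⟩)

/-- Elementary divisor ring: all rectangular matrices admit diagonal reduction. -/
def IsElementaryDivisorRing (R : Type*) [CommRing R] : Prop :=
  ∀ (m n : ℕ) (A : Matrix (Fin m) (Fin n) R), AdmitsDiagonalReduction A

/-- `A` is obtained from a matrix in `SL₃(R)` by removing the third row and the third column. -/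
def IsExtendable {R : Type*} [CommRing R] (A : Matrix (Fin 2) (Fin 2) R) : Prop :=
  ∃ B : Matrix.SpecialLinearGroup (Fin 3) R,
    (B : Matrix (Fin 3) (Fin 3) R).submatrix Fin.castSucc Fin.castSucc = A

/-- `Π₂` ring: every unimodular `2 × 2` matrix of zero determinant is extendable. -/
def IsPi2Ring (R : Type*) [CommRing R] : Prop :=
  ∀ A : Matrix (Fin 2) (Fin 2) R, IsUnimodular R A → A.det = 0 → IsExtendable A

/-- `A` is congruent modulo the ideal `R det(A)` to a matrix of zero determinant. -/
def IsWeaklyDeterminantLiftable {R : Type*} [CommRing R] (A : Matrix (Fin 2) (Fin 2) R) : Prop :=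
  ∃ B : Matrix (Fin 2) (Fin 2) R,
    (∀ i j, B i j - A i j ∈ Ideal.span {A.det}) ∧ B.det = 0

/-!
The notion behind the proof is that of a `2 × 2` matrix `A` whose bilinear form takes the value `1`,
that is, `e A f = 1` for some vectors `e` and `f` (`RepresentsOne`). It ties the other notions
together:

* if `e A f = 1`, then `A` is extendable, and conversely when `det A = 0`; also the rank one matrix
  `(A f) (e A)` is a weak determinant lift of `A`;
* over any quotient of an elementary divisor ring, all unimodular `2 × 2` matrices represent `1`
  (`IsElementaryDivisorRing.representsOne`), which gives both (i) and (ii);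
* conversely, a Hermite ring all of whose unimodular `2 × 2` matrices represent `1` is an elementary
  divisor ring (`IsHermiteRing.isElementaryDivisorRing`). Here one shows that for every matrix `A`
  some value `e A f` divides all entries of `A`. This passes from two rows to any number of rows,
  and by transposition from `2 × 2` matrices to all sizes. After division by their contents, `e` and
  `f` extend to bases, and clearing the first row and column leaves a smaller matrix.

It remains to see that (i) and (ii) make every unimodular `A` represent `1`
(`IsWeaklyDeterminantLiftable.representsOne`). Let `d B` be a lift of zero determinant given by (ii),
with `B` unimodular. As `R` is reduced, `d² det B = 0` implies `d det B = 0`, so by (i) the matrix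
`B` represents `1` over `R / Ann(d)`, and `d B` represents `d` over `R`. Since `A` is congruent to
`d B` modulo `det A`, the element `d` is a unit modulo `det A`, so `e A f` is congruent to `1` modulo
`det A` for suitable `e` and `f`. With `e` unimodular, which can be arranged over a Hermite ring,
`det A` is itself a value `e A f'`, and the error term can be removed
(`IsHermiteRing.representsOne_of_add_mul_det`).

For the reformulation of (ii), invertible row operations make `A` upper triangular with entries
`a, b, c`. A matrix congruent to `A` modulo `det A = a c` has determinant `a c E`, where `E = 0` is
the stated equation, and a solution of `a c E = 0` can be corrected to one of `E = 0`
(`isWeaklyDeterminantLiftable_upperTriangular_iff`).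
-/

open Matrix

/-! ### Unimodular elements in coordinates -/

theorem isUnimodular_iff_exists_dotProduct {R ι : Type*} [CommRing R] [Fintype ι] (v : ι → R) :
    IsUnimodular R v ↔ ∃ w : ι → R, w ⬝ᵥ v = 1 := by
  classical
  constructor
  · rintro ⟨f, hf⟩
    refine ⟨fun i => f (Pi.single i 1), ?_⟩
    refine Eq.trans ?_ ((f.pi_apply_eq_sum_univ v).symm.trans hf)
    refine Finset.sum_congr rfl fun i _ => ?_
    rw [smul_eq_mul, mul_comm]
    refine congrArg (v i * f ·) (funext fun j => ?_)
    simp [Pi.single_apply, eq_comm]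
  · rintro ⟨w, hw⟩
    exact ⟨dotProductBilin R R w, hw⟩

theorem isUnimodular_matrix_iff {R : Type*} [CommRing R] (A : Matrix (Fin 2) (Fin 2) R) :
    IsUnimodular R A ↔
      ∃ p q r s : R, p * A 0 0 + q * A 0 1 + r * A 1 0 + s * A 1 1 = 1 := by
  constructor
  · rintro ⟨f, hf⟩
    refine ⟨f (single 0 0 1), f (single 0 1 1), f (single 1 0 1), f (single 1 1 1), ?_⟩
    have hA : A = A 0 0 • single 0 0 1 + A 0 1 • single 0 1 1 + A 1 0 • single 1 0 1
        + A 1 1 • single 1 1 1 := by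
      ext i j
      fin_cases i <;> fin_cases j <;> simp [single]
    have := congrArg f hA
    simp only [map_add, map_smul, smul_eq_mul] at this
    linear_combination hf - this
  · rintro ⟨p, q, r, s, h⟩
    exact ⟨p • entryLinearMap R R 0 0 + q • entryLinearMap R R 0 1 + r • entryLinearMap R R 1 0
      + s • entryLinearMap R R 1 1, by simpa using h⟩

/-! ### Matrices representing the value one -/

/-- The bilinear form `(e, f) ↦ e A f` of the matrix `A` takes the value `1`. For a `2 × 2` matrix
this says that `A` is equivalent to `diag(1, det A)`, or that it extends to a matrix in `SL₃(R)`
whose last diagonal entry is `0`. -/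
def RepresentsOne {R m n : Type*} [CommRing R] [Fintype m] [Fintype n] (A : Matrix m n R) : Prop :=
  ∃ (e : m → R) (f : n → R), e ⬝ᵥ A *ᵥ f = 1

theorem dotProduct_mulVec_fin_two {R : Type*} [CommRing R] (A : Matrix (Fin 2) (Fin 2) R)
    (e f : Fin 2 → R) :
    e ⬝ᵥ A *ᵥ f = e 0 * A 0 0 * f 0 + e 0 * A 0 1 * f 1 + e 1 * A 1 0 * f 0
      + e 1 * A 1 1 * f 1 := by
  simp only [dotProduct, mulVec, Fin.sum_univ_two]
  ring

/-- If `e A f = 1`, bordering `A` with suitably rotated copies of `e` and `f`, and with `0` in the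
corner, yields determinant `e A f`. -/
theorem RepresentsOne.isExtendable {R : Type*} [CommRing R] {A : Matrix (Fin 2) (Fin 2) R}
    (h : RepresentsOne A) : IsExtendable A := by
  obtain ⟨e, f, h⟩ := h
  rw [dotProduct_mulVec_fin_two] at h
  refine ⟨⟨!![A 0 0, A 0 1, e 1; A 1 0, A 1 1, -e 0; -f 1, f 0, 0], ?_⟩, ?_⟩
  · rw [det_fin_three]
    simp
    linear_combination h
  · ext i j
    fin_cases i <;> fin_cases j <;> rfl

theorem IsExtendable.representsOne {R : Type*} [CommRing R] {A : Matrix (Fin 2) (Fin 2) R}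
    (h : IsExtendable A) (hA : A.det = 0) : RepresentsOne A := by
  obtain ⟨⟨B, hB⟩, h⟩ := h
  subst h
  rw [det_fin_three] at hB
  rw [det_fin_two] at hA
  change B 0 0 * B 1 1 - B 0 1 * B 1 0 = 0 at hA
  refine ⟨![-B 1 2, B 0 2], ![B 2 1, -B 2 0], ?_⟩
  rw [dotProduct_mulVec_fin_two]
  change -B 1 2 * B 0 0 * B 2 1 + -B 1 2 * B 0 1 * -B 2 0 + B 0 2 * B 1 0 * B 2 1
    + B 0 2 * B 1 1 * -B 2 0 = 1
  linear_combination hB - B 2 2 * hA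

/-- If `e A f = 1`, the rank one matrix `(A f) (e A)` is congruent to `A` modulo `det A`. -/
theorem RepresentsOne.isWeaklyDeterminantLiftable {R : Type*} [CommRing R]
    {A : Matrix (Fin 2) (Fin 2) R} (h : RepresentsOne A) : IsWeaklyDeterminantLiftable A := by
  obtain ⟨e, f, h⟩ := h
  rw [dotProduct_mulVec_fin_two] at h
  refine ⟨vecMulVec (A *ᵥ f) (e ᵥ* A), fun i j => ?_, ?_⟩
  · rw [Ideal.mem_span_singleton, det_fin_two]
    simp only [vecMulVec_apply, mulVec, vecMul, dotProduct, Fin.sum_univ_two]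
    fin_cases i <;> fin_cases j
    · exact ⟨-(e 1 * f 1), by simp; linear_combination A 0 0 * h⟩
    · exact ⟨e 1 * f 0, by simp; linear_combination A 0 1 * h⟩
    · exact ⟨e 0 * f 1, by simp; linear_combination A 1 0 * h⟩
    · exact ⟨-(e 0 * f 0), by simp; linear_combination A 1 1 * h⟩
  · rw [det_fin_two]
    simp only [vecMulVec_apply]
    ring

/-- Quotients of an elementary divisor ring: the first diagonal entry in a diagonal reduction of a
lift of `A` divides all entries of `A`, so it becomes a unit. -/
theorem IsElementaryDivisorRing.representsOne {R S : Type*} [CommRing R] [CommRing S]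
    (hR : IsElementaryDivisorRing R) (φ : R →+* S) (hφ : Function.Surjective φ)
    {A : Matrix (Fin 2) (Fin 2) S} (hA : IsUnimodular S A) : RepresentsOne A := by
  obtain ⟨p, q, r, s, hA⟩ := (isUnimodular_matrix_iff A).1 hA
  choose ψ hψ using hφ
  obtain ⟨M, N, D, hD, hoff, hdvd⟩ := hR 2 2 (A.map ψ)
  have h01 : D 0 1 = 0 := hoff 0 1 (by simp)
  have h10 : D 1 0 = 0 := hoff 1 0 (by simp)
  obtain ⟨k, hk⟩ : D 0 0 ∣ D 1 1 := hdvd 0 (by simp) (by simp)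
  have hdiv : ∀ i j, D 0 0 ∣ A.map ψ i j := by
    have hinv : A.map ψ = (↑M⁻¹ : Matrix (Fin 2) (Fin 2) R) * D
        * (↑N⁻¹ : Matrix (Fin 2) (Fin 2) R) := by
      rw [← hD]
      simp only [Matrix.mul_assoc, Units.mul_inv, Matrix.mul_one]
      rw [← Matrix.mul_assoc, Units.inv_mul, Matrix.one_mul]
    intro i j
    rw [hinv]
    simp only [Matrix.mul_apply, Fin.sum_univ_two, h01, h10, hk]
    exact ⟨(↑M⁻¹ : Matrix (Fin 2) (Fin 2) R) i 0 * (↑N⁻¹ : Matrix (Fin 2) (Fin 2) R) 0 j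
      + (↑M⁻¹ : Matrix (Fin 2) (Fin 2) R) i 1 * k * (↑N⁻¹ : Matrix (Fin 2) (Fin 2) R) 1 j, by ring⟩
  have hdiv' : ∀ i j, φ (D 0 0) ∣ A i j := fun i j => by
    have := map_dvd φ (hdiv i j)
    rwa [map_apply, hψ] at this
  obtain ⟨u, hu⟩ : φ (D 0 0) ∣ 1 := by
    rw [← hA]
    exact dvd_add (dvd_add (dvd_add ((hdiv' _ _).mul_left _) ((hdiv' _ _).mul_left _))
      ((hdiv' _ _).mul_left _)) ((hdiv' _ _).mul_left _)
  refine ⟨fun i => u * φ (M.1 0 i), fun j => φ (N.1 j 0), ?_⟩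
  have h00 : φ ((M.1 * A.map ψ * N.1) 0 0) = φ (D 0 0) := by rw [← hD]
  simp only [Matrix.mul_apply, Fin.sum_univ_two, map_add, map_mul, map_apply, hψ] at h00
  rw [dotProduct_mulVec_fin_two, hu]
  linear_combination u * h00

/-! ### Bordered matrices -/

/-- The block matrix with corner `a`, first row `r`, first column `c` and remaining block `Z`. -/
def bordered {R : Type*} {m n : ℕ} (a : R) (r : Fin n → R) (c : Fin m → R)
    (Z : Matrix (Fin m) (Fin n) R) : Matrix (Fin (m + 1)) (Fin (n + 1)) R :=
  Matrix.of (Fin.cons (Fin.cons a r) fun i => Fin.cons (c i) (Z i))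

section bordered

variable {R : Type*} {m n : ℕ} (a : R) (r : Fin n → R) (c : Fin m → R)
  (Z : Matrix (Fin m) (Fin n) R)

@[simp] theorem bordered_zero_zero : bordered a r c Z 0 0 = a := rfl

@[simp] theorem bordered_zero_succ (j : Fin n) : bordered a r c Z 0 j.succ = r j := rfl

@[simp] theorem bordered_succ_zero (i : Fin m) : bordered a r c Z i.succ 0 = c i := rfl

@[simp] theorem bordered_succ_succ (i : Fin m) (j : Fin n) :
    bordered a r c Z i.succ j.succ = Z i j := rfl

theorem eq_bordered (A : Matrix (Fin (m + 1)) (Fin (n + 1)) R) :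
    A = bordered (A 0 0) (fun j => A 0 j.succ) (fun i => A i.succ 0)
      (A.submatrix Fin.succ Fin.succ) := by
  ext i j
  refine Fin.cases ?_ (fun i => ?_) i <;> refine Fin.cases ?_ (fun j => ?_) j <;> rfl

theorem bordered_mul_bordered [CommRing R] {l : ℕ} (a' : R) (r' : Fin l → R) (c' : Fin n → R)
    (Z' : Matrix (Fin n) (Fin l) R) :
    bordered a r c Z * bordered a' r' c' Z' =
      bordered (a * a' + r ⬝ᵥ c') (a • r' + r ᵥ* Z') (a' • c + Z *ᵥ c')
        (vecMulVec c r' + Z * Z') := by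
  ext i j
  refine Fin.cases ?_ (fun i => ?_) i <;> refine Fin.cases ?_ (fun j => ?_) j <;>
    simp [Matrix.mul_apply, Fin.sum_univ_succ, dotProduct, vecMul, mulVec, vecMulVec_apply, mul_comm]

theorem bordered_one [CommRing R] : bordered 1 0 0 (1 : Matrix (Fin n) (Fin n) R) = 1 := by
  ext i j
  refine Fin.cases ?_ (fun i => ?_) i <;> refine Fin.cases ?_ (fun j => ?_) j <;>
    simp [Matrix.one_apply, Fin.succ_ne_zero, (Fin.succ_ne_zero _).symm]

end bordered

/-- The block diagonal invertible matrix `1 ⊕ N`. -/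
def borderedGL {R : Type*} [CommRing R] {n : ℕ} (N : GL (Fin n) R) : GL (Fin (n + 1)) R where
  val := bordered 1 0 0 N
  inv := bordered 1 0 0 (↑N⁻¹ : Matrix (Fin n) (Fin n) R)
  val_inv := by simp [bordered_mul_bordered, bordered_one]
  inv_val := by simp [bordered_mul_bordered, bordered_one]

/-- The block diagonal invertible matrix with a `2 × 2` block of determinant `1` followed by an
identity block. -/
def squareGL {R : Type*} [CommRing R] {n : ℕ} (p q s t : R) (h : s * p + t * q = 1) :
    GL (Fin (n + 2)) R where
  val := bordered p (Fin.cons (-t) 0) (Fin.cons q 0) (bordered s 0 0 1)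
  inv := bordered s (Fin.cons t 0) (Fin.cons (-q) 0) (bordered p 0 0 1)
  val_inv := by
    rw [← bordered_one, ← bordered_one]
    ext i j
    refine Fin.cases ?_ (Fin.cases ?_ fun i => ?_) i <;>
      refine Fin.cases ?_ (Fin.cases ?_ fun j => ?_) j <;>
      simp [Matrix.mul_apply, Fin.sum_univ_succ, Matrix.one_apply,
        -Fin.succ_zero_eq_one, -Fin.succ_zero_eq_one', mul_comm] <;>
      linear_combination h
  inv_val := by
    rw [← bordered_one, ← bordered_one]
    ext i j
    refine Fin.cases ?_ (Fin.cases ?_ fun i => ?_) i <;>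
      refine Fin.cases ?_ (Fin.cases ?_ fun j => ?_) j <;>
      simp [Matrix.mul_apply, Fin.sum_univ_succ, Matrix.one_apply,
        -Fin.succ_zero_eq_one, -Fin.succ_zero_eq_one', mul_comm] <;>
      linear_combination h

/-! ### Hermite rings -/

/-- Every nonempty vector over a Hermite ring is a multiple of a vector which is the first column
of an invertible matrix. -/
theorem IsHermiteRing.exists_smul_col {R : Type*} [CommRing R] (hR : IsHermiteRing R) {n : ℕ}
    (v : Fin (n + 1) → R) : ∃ (d : R) (N : GL (Fin (n + 1)) R), ∀ i, v i = d * N.1 i 0 := by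
  induction n with
  | zero =>
    exact ⟨v 0, 1, fun i => by fin_cases i; simp⟩
  | succ n ih =>
    obtain ⟨d', N', h'⟩ := ih fun i => v i.succ
    obtain ⟨d, u, hu, hv⟩ := hR ![v 0, d']
    obtain ⟨w, hw⟩ := (isUnimodular_iff_exists_dotProduct u).1 hu
    simp only [dotProduct, Fin.sum_univ_two] at hw
    have h0 : v 0 = d * u 0 := congrFun hv 0
    have h1 : d' = d * u 1 := congrFun hv 1
    refine ⟨d, borderedGL N' * squareGL (u 0) (u 1) (w 0) (w 1) hw, fun i => ?_⟩
    refine Fin.cases ?_ (fun i => ?_) i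
    · simp [borderedGL, squareGL, bordered_mul_bordered, h0]
    · rw [h', h1]
      simp [borderedGL, squareGL, bordered_mul_bordered, mulVec, dotProduct, Fin.sum_univ_succ]
      ring

/-- Every `2 × 2` matrix over a Hermite ring is a multiple of a unimodular one. -/
theorem IsHermiteRing.exists_smul_isUnimodular {R : Type*} [CommRing R] (hR : IsHermiteRing R)
    (A : Matrix (Fin 2) (Fin 2) R) :
    ∃ (d : R) (B : Matrix (Fin 2) (Fin 2) R), IsUnimodular R B ∧ A = d • B := by
  obtain ⟨d, N, h⟩ : ∃ (d : R) (N : GL (Fin 4) R), ∀ i, ![A 0 0, A 0 1, A 1 0, A 1 1] i =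
      d * N.1 i 0 := hR.exists_smul_col _
  refine ⟨d, !![N.1 0 0, N.1 1 0; N.1 2 0, N.1 3 0], ?_, ?_⟩
  · rw [isUnimodular_matrix_iff]
    have h1 : ((↑N⁻¹ : Matrix (Fin 4) (Fin 4) R) * N.1) 0 0 = 1 := by
      rw [Units.inv_mul]; rfl
    simp only [Matrix.mul_apply, Fin.sum_univ_four] at h1
    exact ⟨_, _, _, _, h1⟩
  · ext i j
    fin_cases i <;> fin_cases j
    exacts [h 0, h 1, h 2, h 3]

/-! ### Diagonal reduction over Hermite rings -/

/-- The bilinear form of `A` takes a value that divides all entries of `A`, and hence generates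
the ideal generated by these entries. -/
def RepresentsContent {R m n : Type*} [CommRing R] [Fintype m] [Fintype n] (A : Matrix m n R) :
    Prop :=
  ∃ (e : m → R) (f : n → R), ∀ i j, e ⬝ᵥ A *ᵥ f ∣ A i j

theorem RepresentsContent.transpose {R m n : Type*} [CommRing R] [Fintype m] [Fintype n]
    {A : Matrix m n R} (h : RepresentsContent A) : RepresentsContent Aᵀ := by
  obtain ⟨e, f, h⟩ := h
  refine ⟨f, e, fun i j => ?_⟩
  rw [mulVec_transpose, dotProduct_comm, ← dotProduct_mulVec]
  exact h j i

/-- If `e A' f` generates the ideal of entries of the matrix `A'` of all rows but the first, then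
so do the entries of the single row `e A'`; this reduces the number of rows to two. -/
theorem representsContent_of_two_rows {R n : Type*} [CommRing R] [Fintype n]
    (h2 : ∀ A : Matrix (Fin 2) n R, RepresentsContent A) {m : ℕ} (A : Matrix (Fin m) n R) :
    RepresentsContent A := by
  induction m with
  | zero => exact ⟨0, 0, fun i => i.elim0⟩
  | succ m ih =>
    obtain ⟨e, f, h⟩ := ih (A.submatrix Fin.succ id)
    obtain ⟨e₂, f₂, h₂⟩ := h2 (Matrix.of ![A 0, e ᵥ* A.submatrix Fin.succ id])
    have key : (Fin.cons (e₂ 0) (e₂ 1 • e) : Fin (m + 1) → R) ⬝ᵥ A *ᵥ f₂ =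
        e₂ ⬝ᵥ (Matrix.of ![A 0, e ᵥ* A.submatrix Fin.succ id]) *ᵥ f₂ := by
      have h1 : (e ᵥ* A.submatrix Fin.succ id) ⬝ᵥ f₂ = e ⬝ᵥ fun i => (A *ᵥ f₂) i.succ := by
        rw [← dotProduct_mulVec]; rfl
      have hr : e₂ ⬝ᵥ (Matrix.of ![A 0, e ᵥ* A.submatrix Fin.succ id]) *ᵥ f₂ =
          e₂ 0 * (A 0 ⬝ᵥ f₂) + e₂ 1 * ((e ᵥ* A.submatrix Fin.succ id) ⬝ᵥ f₂) := by
        rw [dotProduct, Fin.sum_univ_two]; rfl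
      rw [hr, h1, dotProduct, Fin.sum_univ_succ]
      congr 1
      simp [dotProduct, Finset.mul_sum, mul_assoc]
    refine ⟨Fin.cons (e₂ 0) (e₂ 1 • e), f₂, fun i j => ?_⟩
    rw [key]
    refine Fin.cases (h₂ 0 j) (fun i => ?_) i
    refine dvd_trans ?_ (h i j)
    rw [dotProduct_mulVec e]
    exact Finset.dvd_sum fun k _ => (h₂ 1 k).mul_right _

theorem IsHermiteRing.representsContent {R : Type*} [CommRing R] (hR : IsHermiteRing R)
    (h : ∀ A : Matrix (Fin 2) (Fin 2) R, IsUnimodular R A → RepresentsOne A) {m n : ℕ}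
    (A : Matrix (Fin m) (Fin n) R) : RepresentsContent A := by
  refine representsContent_of_two_rows (fun A => ?_) A
  rw [← A.transpose_transpose]
  refine (representsContent_of_two_rows (fun A => ?_) _).transpose
  obtain ⟨d, B, hB, rfl⟩ := hR.exists_smul_isUnimodular A
  obtain ⟨e, f, hef⟩ := h B hB
  refine ⟨e, f, fun i j => ⟨B i j, ?_⟩⟩
  rw [smul_mulVec, dotProduct_smul, hef, Matrix.smul_apply]
  simp

/-- Kaplansky's criterion: over a Hermite ring, diagonal reduction of unimodular `2 × 2` matrices
implies that of all matrices. -/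
theorem IsHermiteRing.isElementaryDivisorRing {R : Type*} [CommRing R] (hR : IsHermiteRing R)
    (h : ∀ A : Matrix (Fin 2) (Fin 2) R, IsUnimodular R A → RepresentsOne A) :
    IsElementaryDivisorRing R := by
  intro m
  induction m with
  | zero => exact fun n A => ⟨1, 1, A, by simp, fun i => i.elim0, fun k hk => by omega⟩
  | succ m ih =>
    intro n A
    cases n with
    | zero => exact ⟨1, 1, A, by simp, fun _ j => j.elim0, fun k _ hk => by omega⟩
    | succ n =>
      obtain ⟨e, f, hef⟩ := hR.representsContent h A
      obtain ⟨g, M, hM⟩ := hR.exists_smul_col e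
      obtain ⟨k, N, hN⟩ := hR.exists_smul_col f
      -- The columns `e / g` and `f / k` can be completed to bases; in these bases the corner
      -- entry divides `e A f`, hence all entries.
      have hcorner : e ⬝ᵥ A *ᵥ f = g * k * (M.1ᵀ * A * N.1) 0 0 := by
        simp only [Matrix.mul_apply, dotProduct, mulVec, hM, hN, transpose_apply, Finset.mul_sum,
          Finset.sum_mul]
        rw [Finset.sum_comm]
        refine Finset.sum_congr rfl fun i _ => Finset.sum_congr rfl fun j _ => by ring
      have hdvd : ∀ i j, (M.1ᵀ * A * N.1) 0 0 ∣ (M.1ᵀ * A * N.1) i j := fun i j => by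
        have hA : ∀ i j, (M.1ᵀ * A * N.1) 0 0 ∣ A i j := fun i j =>
          (Dvd.intro_left _ hcorner.symm).trans (hef i j)
        generalize (M.1ᵀ * A * N.1) 0 0 = t at hA ⊢
        rw [Matrix.mul_apply]
        refine Finset.dvd_sum fun l _ => Dvd.dvd.mul_right ?_ _
        rw [Matrix.mul_apply]
        exact Finset.dvd_sum fun l' _ => (hA l' l).mul_left _
      obtain ⟨X, hX⟩ : ∃ X, M.1ᵀ * A * N.1 = X := ⟨_, rfl⟩
      rw [hX] at hdvd
      choose Y hY using hdvd
      let y : Fin m → R := fun i => Y i.succ 0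
      let x : Fin n → R := fun j => Y 0 j.succ
      let Z : Matrix (Fin m) (Fin n) R := fun i j => Y i.succ j.succ
      have hXb : X = bordered (X 0 0) (X 0 0 • x) (X 0 0 • y) (X 0 0 • Z) := by
        conv_lhs => rw [eq_bordered X]
        congr 1
        · exact funext fun j => hY _ _
        · exact funext fun i => hY _ _
        · ext i j
          exact hY _ _
      obtain ⟨M', N', D, hD, hoff, hdiv⟩ := ih n (Z - vecMulVec y x)
      let L : GL (Fin (m + 1)) R :=
        ⟨bordered 1 0 (-y) 1, bordered 1 0 y 1, by simp [bordered_mul_bordered, bordered_one],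
          by simp [bordered_mul_bordered, bordered_one]⟩
      let U : GL (Fin (n + 1)) R :=
        ⟨bordered 1 (-x) 0 1, bordered 1 x 0 1, by simp [bordered_mul_bordered, bordered_one],
          by simp [bordered_mul_bordered, bordered_one]⟩
      let Mt : GL (Fin (m + 1)) R :=
        ⟨M.1ᵀ, (↑M⁻¹ : Matrix _ _ R)ᵀ, by rw [← transpose_mul, Units.inv_mul, transpose_one],
          by rw [← transpose_mul, Units.mul_inv, transpose_one]⟩
      have hLXU : L.1 * X * U.1 = bordered (X 0 0) 0 0 (X 0 0 • (Z - vecMulVec y x)) := by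
        conv_lhs => rw [hXb]
        simp only [L, U, bordered_mul_bordered]
        congr 1
        · simp
        · simp
        · simp
        · ext i j
          simp [vecMulVec_apply]
          ring
      refine ⟨borderedGL M' * L * Mt, N * U * borderedGL N', bordered (X 0 0) 0 0 (X 0 0 • D),
        ?_, ?_, ?_⟩
      · have : (borderedGL M' * L * Mt).1 * A * (N * U * borderedGL N').1 =
            (borderedGL M').1 * (L.1 * (M.1ᵀ * A * N.1) * U.1) * (borderedGL N').1 := by
          simp only [Units.val_mul, Matrix.mul_assoc, Mt]
        rw [this, hX, hLXU, ← hD]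
        simp [borderedGL, bordered_mul_bordered]
      · intro i j
        refine Fin.cases ?_ (fun i => ?_) i <;> refine Fin.cases ?_ (fun j => ?_) j
        · simp
        · simp
        · simp
        · intro hij
          simp [hoff i j (by simpa using hij)]
      · intro l hm hn
        cases l with
        | zero => exact dvd_mul_right _ _
        | succ l => exact mul_dvd_mul_left _ (hdiv l (by omega) (by omega))

/-! ### Weakly determinant liftable matrices -/

/-- If `e A f` is a unit modulo `det A`, then after division by its content the vector `e` makes
`e A` unimodular: `det A` lies in the ideal generated by the entries of `e A`. -/
theorem IsHermiteRing.representsOne_of_add_mul_det {R : Type*} [CommRing R] (hR : IsHermiteRing R)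
    {A : Matrix (Fin 2) (Fin 2) R} {e f : Fin 2 → R} {k : R}
    (h : e ⬝ᵥ A *ᵥ f + k * A.det = 1) : RepresentsOne A := by
  obtain ⟨g, N, hN⟩ : ∃ (g : R) (N : GL (Fin 2) R), ∀ i, e i = g * N.1 i 0 :=
    hR.exists_smul_col e
  have h1 : ((↑N⁻¹ : Matrix (Fin 2) (Fin 2) R) * N.1) 0 0 = 1 := by
    rw [Units.inv_mul]; rfl
  obtain ⟨s, hs⟩ : ∃ s, s = (↑N⁻¹ : Matrix (Fin 2) (Fin 2) R) 0 := ⟨_, rfl⟩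
  simp only [Matrix.mul_apply, Fin.sum_univ_two, ← hs] at h1
  refine ⟨fun i => N.1 i 0, g • f + k • A.adjugate *ᵥ s, ?_⟩
  rw [dotProduct_mulVec_fin_two, hN, hN, det_fin_two] at h
  rw [dotProduct_mulVec_fin_two, adjugate_fin_two]
  simp [dotProduct, Fin.sum_univ_two]
  linear_combination h + k * (A 0 0 * A 1 1 - A 0 1 * A 1 0) * h1

/-- A congruence `A ≡ d B` modulo `det A` with `d² det B = 0` and `B` unimodular: the ring is
reduced, so `B` has zero determinant over `R / Ann(d)`, where it represents `1`; thus `d B`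
represents `d`, which is a unit modulo `det A`. -/
theorem IsWeaklyDeterminantLiftable.representsOne {R : Type*} [CommRing R] [IsReduced R]
    (hR : IsHermiteRing R) (hP : ∀ a : R, IsPi2Ring (R ⧸ (Ideal.span {a}).annihilator))
    {A : Matrix (Fin 2) (Fin 2) R} (hA : IsUnimodular R A)
    (h : IsWeaklyDeterminantLiftable A) : RepresentsOne A := by
  obtain ⟨p, q, r, s, hA⟩ := (isUnimodular_matrix_iff A).1 hA
  obtain ⟨B', hB', hdet⟩ := h
  obtain ⟨d, B, hB, rfl⟩ := hR.exists_smul_isUnimodular B'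
  simp only [Ideal.mem_span_singleton] at hB'
  choose C hC using hB'
  let I := (Ideal.span {d}).annihilator
  have hmem : ∀ x, x ∈ I ↔ x * d = 0 := fun x => by
    simp only [I]
    exact Submodule.mem_annihilator_span_singleton d x
  have hdB : B.det * d = 0 := by
    refine IsReduced.eq_zero _ ⟨2, ?_⟩
    rw [det_smul, Fintype.card_fin] at hdet
    linear_combination B.det * hdet
  obtain ⟨e, f, hef⟩ : RepresentsOne (B.map (Ideal.Quotient.mk I)) := by
    refine (hP d _ ?_ ?_).representsOne ?_
    · obtain ⟨p, q, r, s, h⟩ := (isUnimodular_matrix_iff B).1 hB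
      refine (isUnimodular_matrix_iff _).2 ⟨Ideal.Quotient.mk I p, Ideal.Quotient.mk I q,
        Ideal.Quotient.mk I r, Ideal.Quotient.mk I s, ?_⟩
      simp only [map_apply, ← map_mul, ← map_add, h, map_one]
    all_goals
      rw [← RingHom.mapMatrix_apply, ← RingHom.map_det]
      exact Ideal.Quotient.eq_zero_iff_mem.2 ((hmem _).2 hdB)
  choose ψ hψ using Ideal.Quotient.mk_surjective (I := I)
  rw [dotProduct_mulVec_fin_two] at hef
  have hval : (ψ (e 0) * B 0 0 * ψ (f 0) + ψ (e 0) * B 0 1 * ψ (f 1) + ψ (e 1) * B 1 0 * ψ (f 0)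
      + ψ (e 1) * B 1 1 * ψ (f 1) - 1) * d = 0 := by
    rw [← hmem, ← Ideal.Quotient.eq_zero_iff_mem]
    simp only [map_sub, map_add, map_mul, hψ, map_one]
    exact sub_eq_zero.2 hef
  have hC' : ∀ i j, A i j = d * B i j - A.det * C i j := fun i j => by
    have := hC i j
    rw [Matrix.smul_apply, smul_eq_mul] at this
    linear_combination -this
  -- The factor `σ` is an inverse of `d` modulo `det A`.
  obtain ⟨σ, hσ⟩ : ∃ σ, σ = p * B 0 0 + q * B 0 1 + r * B 1 0 + s * B 1 1 := ⟨_, rfl⟩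
  obtain ⟨δ, hδ⟩ : ∃ δ, δ = A.det := ⟨_, rfl⟩
  rw [← hδ] at hC'
  refine hR.representsOne_of_add_mul_det (e := fun i => σ * ψ (e i)) (f := fun i => ψ (f i))
    (k := σ * (ψ (e 0) * C 0 0 * ψ (f 0) + ψ (e 0) * C 0 1 * ψ (f 1) + ψ (e 1) * C 1 0 * ψ (f 0)
      + ψ (e 1) * C 1 1 * ψ (f 1)) - (p * C 0 0 + q * C 0 1 + r * C 1 0 + s * C 1 1)) ?_
  rw [dotProduct_mulVec_fin_two, ← hδ]
  simp only [hC'] at hA ⊢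
  linear_combination σ * hval + hA + d * hσ

/-- Over a Hermite ring it suffices to treat upper triangular matrices. -/
theorem IsHermiteRing.isWeaklyDeterminantLiftable_of_upperTriangular {R : Type*} [CommRing R]
    (hR : IsHermiteRing R)
    (h : ∀ a b c : R, IsUnimodular R !![a, b; 0, c] → IsWeaklyDeterminantLiftable !![a, b; 0, c])
    {A : Matrix (Fin 2) (Fin 2) R} (hA : IsUnimodular R A) : IsWeaklyDeterminantLiftable A := by
  obtain ⟨d, N, hN⟩ : ∃ (d : R) (N : GL (Fin 2) R), ∀ i, A i 0 = d * N.1 i 0 :=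
    hR.exists_smul_col _
  obtain ⟨T, hT⟩ : ∃ T, T = (↑N⁻¹ : Matrix (Fin 2) (Fin 2) R) * A := ⟨_, rfl⟩
  have hNT : N.1 * T = A := by
    rw [hT, ← Matrix.mul_assoc, Units.mul_inv, Matrix.one_mul]
  have h10 : T 1 0 = 0 := by
    have h1 : ((↑N⁻¹ : Matrix (Fin 2) (Fin 2) R) * N.1) 1 0 = 0 := by
      rw [Units.inv_mul]; rfl
    simp only [Matrix.mul_apply, Fin.sum_univ_two] at h1
    rw [hT, Matrix.mul_apply, Fin.sum_univ_two, hN, hN]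
    linear_combination d * h1
  have hT' : T = !![T 0 0, T 0 1; 0, T 1 1] := by
    conv_lhs => rw [eta_fin_two T, h10]
  have hTu : IsUnimodular R T := by
    obtain ⟨φ, hφ⟩ := hA
    exact ⟨φ ∘ₗ mulLeftLinearMap (Fin 2) R N.1, by simpa [hNT] using hφ⟩
  obtain ⟨B, hB, hdet⟩ : IsWeaklyDeterminantLiftable T := by
    rw [hT'] at hTu ⊢
    exact h _ _ _ hTu
  refine ⟨N.1 * B, fun i j => ?_, by rw [det_mul, hdet, mul_zero]⟩
  have hle : Ideal.span {T.det} ≤ Ideal.span {A.det} := by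
    rw [Ideal.span_singleton_le_span_singleton, hT, det_mul]
    exact dvd_mul_left _ _
  rw [← hNT, ← Matrix.sub_apply, ← Matrix.mul_sub, hNT, Matrix.mul_apply]
  exact Ideal.sum_mem _ fun k _ => Ideal.mul_mem_left _ _ (hle (hB k j))

theorem isUnimodular_upperTriangular_iff {R : Type*} [CommRing R] (a b c : R) :
    IsUnimodular R !![a, b; 0, c] ↔ IsUnimodular R ![a, b, c] := by
  rw [isUnimodular_matrix_iff, isUnimodular_iff_exists_dotProduct]
  constructor
  · rintro ⟨p, q, r, s, h⟩
    exact ⟨![p, q, s], by simpa [dotProduct, Fin.sum_univ_three] using h⟩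
  · rintro ⟨w, h⟩
    exact ⟨w 0, w 1, 0, w 2, by simpa [dotProduct, Fin.sum_univ_three] using h⟩

/-- The determinant of a matrix congruent to `!![a, b; 0, c]` modulo `a * c` is `a * c * E`, where
`E` measures the failure of the equation. When `a * c * E = 0`, unimodularity of `(a, b, c)` allows
a correction by multiples of `E` that makes `E` vanish. -/
theorem isWeaklyDeterminantLiftable_upperTriangular_iff {R : Type*} [CommRing R] {a b c : R}
    (h : IsUnimodular R ![a, b, c]) :
    IsWeaklyDeterminantLiftable !![a, b; 0, c] ↔
      ∃ x y z w : R, (1 - a * x) * (1 - c * w) = y * (b + a * c * z) := by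
  constructor
  · rintro ⟨B, hB, hdet⟩
    obtain ⟨v, hv⟩ := (isUnimodular_iff_exists_dotProduct _).1 h
    simp only [dotProduct, Fin.sum_univ_three] at hv
    simp only [Ideal.mem_span_singleton] at hB
    choose C hC using hB
    have h00 := hC 0 0
    have h01 := hC 0 1
    have h10 := hC 1 0
    have h11 := hC 1 1
    simp [det_fin_two] at h00 h01 h10 h11 hv
    rw [det_fin_two] at hdet
    obtain ⟨E, hE⟩ : ∃ E, E = (1 + a * C 1 1) * (1 + c * C 0 0) - C 1 0 * (b + a * c * C 0 1) :=
      ⟨_, rfl⟩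
    have hacE : a * c * E = 0 := by
      rw [hE, ← hdet, eq_add_of_sub_eq h00, eq_add_of_sub_eq h01, h10, eq_add_of_sub_eq h11]
      ring
    refine ⟨-C 1 1 + E * v 0, C 1 0 + E * v 1, C 0 1, -C 0 0 + E * v 2, ?_⟩
    linear_combination -hE - E * hv
      + (E * v 0 * v 2 - v 0 * C 0 0 - v 2 * C 1 1 - v 1 * C 0 1) * hacE
  · rintro ⟨x, y, z, w, h⟩
    refine ⟨!![a * (1 - c * w), b + a * c * z; a * c * y, c * (1 - a * x)], fun i j => ?_, ?_⟩
    · rw [Ideal.mem_span_singleton, det_fin_two]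
      fin_cases i <;> fin_cases j
      · exact ⟨-w, by simp; ring⟩
      · exact ⟨z, by simp⟩
      · exact ⟨y, by simp⟩
      · exact ⟨-x, by simp; ring⟩
    · rw [det_fin_two]
      simp
      linear_combination a * c * h

theorem mainTheorem3 {R : Type*} [CommRing R] [IsReduced R] (hR : IsHermiteRing R) :
    (IsElementaryDivisorRing R ↔
      (∀ a : R, IsPi2Ring (R ⧸ (Ideal.span {a}).annihilator)) ∧
        ∀ A : Matrix (Fin 2) (Fin 2) R, IsUnimodular R A → IsWeaklyDeterminantLiftable A) ∧
    ((∀ A : Matrix (Fin 2) (Fin 2) R, IsUnimodular R A → IsWeaklyDeterminantLiftable A) ↔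
      ∀ a b c : R, IsUnimodular R ![a, b, c] →
        ∃ x y z w : R, (1 - a * x) * (1 - c * w) = y * (b + a * c * z)) := by
  refine ⟨⟨fun h => ⟨fun a A hA _ => ?_, fun A hA => ?_⟩, fun ⟨h₁, h₂⟩ => ?_⟩,
    fun h a b c habc => ?_, fun h A hA => ?_⟩
  · exact (h.representsOne _ Ideal.Quotient.mk_surjective hA).isExtendable
  · exact (h.representsOne (RingHom.id R) Function.surjective_id hA).isWeaklyDeterminantLiftable
  · exact hR.isElementaryDivisorRing fun A hA => (h₂ A hA).representsOne hR h₁ hA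
  · exact (isWeaklyDeterminantLiftable_upperTriangular_iff habc).1
      (h _ ((isUnimodular_upperTriangular_iff a b c).2 habc))
  · refine hR.isWeaklyDeterminantLiftable_of_upperTriangular (fun a b c hu => ?_) hA
    have habc := (isUnimodular_upperTriangular_iff a b c).1 hu
    exact (isWeaklyDeterminantLiftable_upperTriangular_iff habc).2 (h a b c habc)
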